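/- Let $d\in\mathbb N$ and let $p:\mathbb R^d\to[0,\infty)$ be a probability density that is bounded, Lipschitz continuous and twice differentiable; write $P(A)=\int_A p(x)\,dx$. Let $X_1,X_2,\dots$ be independent random vectors in $\mathbb R^d$ with density $p$. For $n\ge 1$ and $\sigma>0$ let $W=(w_{ij})$ be the $n\times n$ matrix with $w_{ii}=0$ and $w_{ij}=(2\pi\sigma^2)^{-d/2}e^{-\|X_i-X_j\|^2/(2\sigma^2)}$ for $i\ne j$, let $D$ be the diagonal matrix with $D_{ii}=\sum_j w_{ij}$, let $L=\frac1n(D-W)$, and let $\mathcal N_L(t)$ be the number of eigenvalues of $L$ that are $\le t$, counted with multiplicity. Let $t\in\mathbb R$ be such that $P(\{x:p(x)=t\})=0$. Then $\frac1n\mathcal N_L(t)$ is an integrable random variable for all $n\ge1$ and $\sigma>0$, and $$\mathbb E\Big[\tfrac1n\mathcal N_L(t)\Big]\longrightarrow P(\{x:p(x)\le t\})$$ as $n\to\infty$ and $\sigma\to0$, in both of the following senses: (i) along every sequence $\sigma=\sigma_n>0$ with $\sigma_n\to0$ and $n\sigma_n^d\to\infty$; (ii) when first $n\to\infty$ and then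 $\sigma\to0$, i.e. for every $\varepsilon>0$ there is $\delta>0$ such that for each $\sigma\in(0,\delta)$ the difference of the two sides has absolute value less than $\varepsilon$ for all sufficiently large $n$. -/

import Mathlib

open MeasureTheory ProbabilityTheory Filter Topology

namespace GraphESD

noncomputable section

/-- The `d`-dimensional Gaussian kernel with variance parameter `v`:
`K_v(x, y) = (2 π v)^(-d/2) exp(-‖x - y‖² / (2 v))`. -/
def gaussianKernel {d : ℕ} (v : ℝ) (x y : EuclideanSpace ℝ (Fin d)) : ℝ :=
  1 / (2 * Real.pi * v) ^ ((d : ℝ) / 2) * Real.exp (-‖x - y‖ ^ 2 / (2 * v))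

/-- The weighted adjacency matrix of the similarity graph on the points `x i`: Gaussian
weights `K_{σ²}` off the diagonal, no self-loops. -/
def weightMatrix {d n : ℕ} (σ : ℝ) (x : Fin n → EuclideanSpace ℝ (Fin d)) :
    Matrix (Fin n) (Fin n) ℝ :=
  Matrix.of fun i j => if i = j then 0 else gaussianKernel (σ ^ 2) (x i) (x j)

/-- The diagonal matrix of the degrees (row sums of the weight matrix). -/
def degreeMatrix {d n : ℕ} (σ : ℝ) (x : Fin n → EuclideanSpace ℝ (Fin d)) :
    Matrix (Fin n) (Fin n) ℝ :=
  Matrix.diagonal fun i => ∑ j, weightMatrix σ x i j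

/-- The graph Laplacian `L = (D - W) / n`. -/
def laplacian {d n : ℕ} (σ : ℝ) (x : Fin n → EuclideanSpace ℝ (Fin d)) :
    Matrix (Fin n) (Fin n) ℝ :=
  (1 / (n : ℝ)) • (degreeMatrix σ x - weightMatrix σ x)

theorem laplacian_isHermitian {d n : ℕ} (σ : ℝ) (x : Fin n → EuclideanSpace ℝ (Fin d)) :
    (laplacian σ x).IsHermitian := by
  ext i j
  by_cases h : i = j
  · subst h
    simp
  · have h' : ¬ j = i := fun e => h e.symm
    simp [laplacian, degreeMatrix, weightMatrix, gaussianKernel, h, h', norm_sub_rev (x j) (x i)]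

/-- `N_L(t)`: the number of eigenvalues of the graph Laplacian that are `≤ t`, counted with
multiplicity (`eigenvalues` lists all `n` eigenvalues with multiplicity). -/
def eigenvalueCount {d n : ℕ} (σ : ℝ) (x : Fin n → EuclideanSpace ℝ (Fin d)) (t : ℝ) : ℕ :=
  (Finset.univ.filter fun i : Fin n => (laplacian_isHermitian σ x).eigenvalues i ≤ t).card

/-- The fraction `N_L(t) / n` for the graph on the first `n` points of the sequence `x`. -/
def eigenvalueFraction {d : ℕ} (n : ℕ) (σ : ℝ) (x : ℕ → EuclideanSpace ℝ (Fin d)) (t : ℝ) : ℝ :=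
  (eigenvalueCount σ (fun i : Fin n => x i) t : ℝ) / n

/-- The measure with density `p`: `P(A) = ∫_A p(x) dx`. -/
def densityMeasure {d : ℕ} (p : EuclideanSpace ℝ (Fin d) → ℝ) :
    Measure (EuclideanSpace ℝ (Fin d)) :=
  volume.withDensity fun x => ENNReal.ofReal (p x)

/-- The data densities considered: probability densities on `ℝ^d` that are bounded,
Lipschitz continuous and twice differentiable. -/
structure IsDataDensity {d : ℕ} (p : EuclideanSpace ℝ (Fin d) → ℝ) : Prop where
  nonneg : ∀ x, 0 ≤ p x
  integrable : Integrable p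
  integral_eq_one : ∫ x, p x = 1
  bounded : ∃ M : ℝ, ∀ x, p x ≤ M
  lipschitz : ∃ C : NNReal, LipschitzWith C p
  differentiable : Differentiable ℝ p
  differentiable_fderiv : Differentiable ℝ (fderiv ℝ p)

end

end GraphESD

/-!
The Laplacian `L` is close, in normalised Frobenius norm, to the diagonal matrix with entries
`p(X_i)`, and the normalised eigenvalue count of that diagonal matrix at `t` has expectation
`P(p ≤ t)`.

*Comparison of counts.* If `A u_i = a_i u_i` and `B v_j = b_j v_j` for orthonormal bases `u`, `v`,
then the matrix `⟨v_j, u_i⟩²` is doubly stochastic and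
`‖A - B‖_F² = ∑ (a_i - b_j)² ⟨v_j, u_i⟩²`. Splitting `#{a_i ≤ s}` along the second index gives
`#{a_i ≤ s} ≤ #{b_j ≤ s + η} + ‖A - B‖_F² / η²` (`card_le_card_add_frobenius`). This also makes the
eigenvalue count upper semicontinuous in the matrix, hence measurable
(`upperSemicontinuous_card_eigenvalues`).

*Size of the defect.* Since `0 ≤ K ≤ c σ^{-d}` and `∫ K(x, y) p(y) dy ≤ sup p`, the second moment of
`K(X_i, X_j)` is `O(σ^{-d})`. The off-diagonal entries therefore contribute `O(1 / (n σ^d))`, and so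
does the variance of the degrees, whose summands are uncorrelated given `X_i`
(`integral_mul_eq_zero_of_centred`). The bias `K * p - p` is `O(σ)` uniformly because `p` is
Lipschitz (`IsDataDensity.abs_smoothedDensity_sub_le`). Altogether
`E ‖L - diag(p(X_i))‖_F² / n = O(1 / (n σ^d)) + O((σ + 1 / n)²)`
(`integral_diagonalDefect_div_le`), which is small in both limits.

*Conclusion.* The expected fraction lies within this error over `η²` of the interval from
`P(p ≤ t - η)` to `P(p ≤ t + η)`, and both ends tend to `P(p ≤ t)` as `η → 0` because `t` is not an
atom of the law of `p` under `P` (`continuousAt_measureReal_le`).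
-/

/-! ### Comparing eigenvalue counts through the Frobenius norm -/

namespace GraphESD

/-- The squared Frobenius norm can be computed in any two orthonormal bases. -/
theorem sum_sq_inner_mulVec {ι : Type*} [Fintype ι] [DecidableEq ι]
    (u v : OrthonormalBasis ι ℝ (EuclideanSpace ℝ ι)) (M : Matrix ι ι ℝ) :
    ∑ i, ∑ j, (inner ℝ (v j) (WithLp.toLp 2 (M.mulVec (u i).ofLp))) ^ 2 =
      ∑ i, ∑ j, M i j ^ 2 := by
  have h1 : ∀ i, ∑ j, (inner ℝ (v j) (WithLp.toLp 2 (M.mulVec (u i).ofLp))) ^ 2 =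
      ∑ k, (inner ℝ (u i) (WithLp.toLp 2 (M k))) ^ 2 := by
    intro i
    have := v.sum_sq_norm_inner_right (WithLp.toLp 2 (M.mulVec (u i).ofLp))
    simp only [Real.norm_eq_abs, sq_abs] at this
    rw [this, EuclideanSpace.norm_sq_eq]
    simp [PiLp.inner_apply, Matrix.mulVec, dotProduct]
  simp_rw [h1]
  rw [Finset.sum_comm]
  refine Finset.sum_congr rfl fun k _ => ?_
  have := u.sum_sq_norm_inner_right (WithLp.toLp 2 (M k))
  simp only [Real.norm_eq_abs, sq_abs] at this
  rw [this, EuclideanSpace.norm_sq_eq]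
  simp

theorem inner_toLp_mulVec {ι : Type*} [Fintype ι] {A : Matrix ι ι ℝ} (hA : A.IsHermitian)
    (x y : EuclideanSpace ℝ ι) :
    inner ℝ x (WithLp.toLp 2 (A.mulVec y.ofLp)) =
      inner ℝ (WithLp.toLp 2 (A.mulVec x.ofLp)) y := by
  have hA' : A.transpose = A := by simpa [Matrix.IsHermitian] using hA
  simp only [EuclideanSpace.inner_eq_star_dotProduct, star_trivial]
  rw [dotProduct_comm, Matrix.dotProduct_mulVec, ← Matrix.mulVec_transpose, hA', dotProduct_comm]

/-- A one-sided comparison of eigenvalue counts, in the spirit of the Hoffman–Wielandt inequality.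
The eigenbases are arguments, so that a diagonal matrix can be used with the standard basis. -/
theorem card_le_card_add_frobenius {ι : Type*} [Fintype ι] [DecidableEq ι]
    {A B : Matrix ι ι ℝ} (hB : B.IsHermitian)
    (u v : OrthonormalBasis ι ℝ (EuclideanSpace ℝ ι)) (a b : ι → ℝ)
    (hu : ∀ i, A.mulVec (u i).ofLp = a i • (u i).ofLp)
    (hv : ∀ i, B.mulVec (v i).ofLp = b i • (v i).ofLp) (s : ℝ) {η : ℝ} (hη : 0 < η) :
    ((Finset.univ.filter fun i => a i ≤ s).card : ℝ) ≤
      (Finset.univ.filter fun i => b i ≤ s + η).card + (∑ i, ∑ j, (A i j - B i j) ^ 2) / η ^ 2 := by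
  -- `S` is doubly stochastic.
  set S : ι → ι → ℝ := fun i j => (inner ℝ (v j) (u i)) ^ 2 with hS
  have hS1 : ∀ i, ∑ j, S i j = 1 := by
    intro i
    have := v.sum_sq_norm_inner_right (u i)
    simpa [hS] using this
  have hS2 : ∀ j, ∑ i, S i j = 1 := by
    intro j
    have := u.sum_sq_norm_inner_left (v j)
    simpa [hS] using this
  have hF : ∑ i, ∑ j, (A i j - B i j) ^ 2 = ∑ i, ∑ j, (a i - b j) ^ 2 * S i j := by
    have := sum_sq_inner_mulVec u v (A - B)
    simp only [Matrix.sub_apply] at this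
    rw [← this]
    refine Finset.sum_congr rfl fun i _ => Finset.sum_congr rfl fun j _ => ?_
    rw [Matrix.sub_mulVec, WithLp.toLp_sub, inner_sub_right, inner_toLp_mulVec hB, hu, hv,
      WithLp.toLp_smul, WithLp.toLp_smul, WithLp.toLp_ofLp, WithLp.toLp_ofLp,
      real_inner_smul_left, real_inner_smul_right]
    simp only [hS]
    ring
  have hA' : ((Finset.univ.filter fun i => a i ≤ s).card : ℝ) =
      ∑ i, ∑ j, if a i ≤ s then S i j else 0 := by
    rw [Finset.card_filter]
    push_cast
    refine Finset.sum_congr rfl fun i _ => ?_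
    by_cases h : a i ≤ s <;> simp [h, hS1]
  have hB' : ((Finset.univ.filter fun i => b i ≤ s + η).card : ℝ) =
      ∑ i, ∑ j, if b j ≤ s + η then S i j else 0 := by
    rw [Finset.card_filter, Finset.sum_comm]
    push_cast
    refine Finset.sum_congr rfl fun j _ => ?_
    by_cases h : b j ≤ s + η <;> simp [h, hS2]
  rw [hA', hB', hF, Finset.sum_div, ← Finset.sum_add_distrib]
  refine Finset.sum_le_sum fun i _ => ?_
  rw [Finset.sum_div, ← Finset.sum_add_distrib]
  refine Finset.sum_le_sum fun j _ => ?_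
  have hSn : 0 ≤ S i j := sq_nonneg _
  have hpos : 0 ≤ (a i - b j) ^ 2 * S i j / η ^ 2 := by positivity
  by_cases h1 : a i ≤ s
  · by_cases h2 : b j ≤ s + η
    · simp only [h1, h2, if_true]; linarith
    · simp only [h1, h2, if_true, if_false, zero_add]
      rw [le_div_iff₀ (by positivity), mul_comm]
      refine mul_le_mul_of_nonneg_right ?_ hSn
      nlinarith
  · simp only [h1, if_false]
    split_ifs <;> linarith

/-- The number of eigenvalues below a fixed level is upper semicontinuous in the matrix. -/
theorem upperSemicontinuous_card_eigenvalues {ι : Type*} [Fintype ι] [DecidableEq ι]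
    {α : Type*} [TopologicalSpace α] {A : α → Matrix ι ι ℝ} (hA : ∀ x, (A x).IsHermitian)
    (hcont : Continuous A) (t : ℝ) :
    UpperSemicontinuous fun x => (Finset.univ.filter fun i => (hA x).eigenvalues i ≤ t).card := by
  intro x k hk
  -- No eigenvalue of `A x` lies in `(t, t + η]`; once `‖A y - A x‖_F < η`, the error term is below
  -- `1`, and the comparison of the two integer counts is exact.
  obtain ⟨η, hη, hgap⟩ : ∃ η : ℝ, 0 < η ∧ ∀ i, (hA x).eigenvalues i ≤ t + η →
      (hA x).eigenvalues i ≤ t := by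
    have : ∀ᶠ η in 𝓝[>] (0 : ℝ), ∀ i, (hA x).eigenvalues i ≤ t + η →
        (hA x).eigenvalues i ≤ t := by
      rw [Filter.eventually_all]
      intro i
      by_cases h : (hA x).eigenvalues i ≤ t
      · exact Filter.Eventually.of_forall fun _ _ => h
      · have h' : 0 < (hA x).eigenvalues i - t := by linarith [not_le.mp h]
        filter_upwards [Ioo_mem_nhdsGT h'] with η hη h2
        linarith [hη.2]
    obtain ⟨η, h1, h2⟩ := (this.and self_mem_nhdsWithin).exists
    exact ⟨η, h2, h1⟩
  have hlim : Tendsto (fun y => ∑ i, ∑ j, (A y i j - A x i j) ^ 2) (𝓝 x) (𝓝 0) := by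
    have : Continuous fun y => ∑ i, ∑ j, (A y i j - A x i j) ^ 2 := by fun_prop
    simpa using this.tendsto x
  filter_upwards [hlim.eventually (gt_mem_nhds (pow_pos hη 2))] with y hy
  refine lt_of_le_of_lt ?_ hk
  have h1 := card_le_card_add_frobenius (A := A y) (B := A x) (hA x) (hA y).eigenvectorBasis
    (hA x).eigenvectorBasis _ _ (hA y).mulVec_eigenvectorBasis (hA x).mulVec_eigenvectorBasis t hη
  have h2 : (∑ i, ∑ j, (A y i j - A x i j) ^ 2) / η ^ 2 < 1 := by
    rwa [div_lt_one (by positivity)]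
  have h3 : (Finset.univ.filter fun i => (hA x).eigenvalues i ≤ t + η).card ≤
      (Finset.univ.filter fun i => (hA x).eigenvalues i ≤ t).card :=
    Finset.card_le_card fun i => by simpa using hgap i
  have h4 : ((Finset.univ.filter fun i => (hA y).eigenvalues i ≤ t).card : ℝ) <
      ((Finset.univ.filter fun i => (hA x).eigenvalues i ≤ t + η).card + 1 : ℕ) := by
    push_cast; linarith
  have h5 := Nat.lt_add_one_iff.mp (Nat.cast_lt.mp h4)
  exact h5.trans h3

theorem continuous_laplacian {d n : ℕ} (σ : ℝ) :
    Continuous fun x : Fin n → EuclideanSpace ℝ (Fin d) => laplacian σ x := by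
  have hW : ∀ i j, Continuous fun x : Fin n → EuclideanSpace ℝ (Fin d) => weightMatrix σ x i j := by
    intro i j
    by_cases h : i = j
    · simp [weightMatrix, h, continuous_const]
    · simp only [weightMatrix, Matrix.of_apply, h, if_false, gaussianKernel]
      fun_prop
  refine continuous_matrix fun i j => ?_
  by_cases h : i = j
  · subst h
    simp only [laplacian, degreeMatrix, Matrix.smul_apply, Matrix.sub_apply,
      Matrix.diagonal_apply_eq, smul_eq_mul]
    fun_prop
  · simp only [laplacian, degreeMatrix, Matrix.smul_apply, Matrix.sub_apply,
      Matrix.diagonal_apply_ne _ h, smul_eq_mul]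
    fun_prop

theorem measurable_eigenvalueFraction {d : ℕ} (n : ℕ) (σ t : ℝ) :
    Measurable fun x : ℕ → EuclideanSpace ℝ (Fin d) => eigenvalueFraction n σ x t := by
  have h : Measurable fun x : Fin n → EuclideanSpace ℝ (Fin d) => eigenvalueCount σ x t :=
    (upperSemicontinuous_card_eigenvalues (laplacian_isHermitian σ)
      (continuous_laplacian σ) t).measurable
  unfold eigenvalueFraction
  have h2 : Measurable fun x : ℕ → EuclideanSpace ℝ (Fin d) =>
      eigenvalueCount σ (fun i : Fin n => x i) t := h.comp (by fun_prop)
  fun_prop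

theorem eigenvalueFraction_nonneg {d : ℕ} (n : ℕ) (σ t : ℝ) (x : ℕ → EuclideanSpace ℝ (Fin d)) :
    0 ≤ eigenvalueFraction n σ x t := by
  unfold eigenvalueFraction; positivity

theorem eigenvalueFraction_le_one {d : ℕ} (n : ℕ) (σ t : ℝ) (x : ℕ → EuclideanSpace ℝ (Fin d)) :
    eigenvalueFraction n σ x t ≤ 1 := by
  refine div_le_one_of_le₀ ?_ (by positivity)
  have := Finset.card_filter_le (Finset.univ : Finset (Fin n))
    fun i => (laplacian_isHermitian σ fun i : Fin n => x i).eigenvalues i ≤ t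
  rw [Finset.card_fin] at this
  exact_mod_cast this

/-- `‖L - diag(f(x_i))‖_F²`, for the Laplacian of the points `x_i`. -/
noncomputable def diagonalDefect {d : ℕ} (f : EuclideanSpace ℝ (Fin d) → ℝ) (n : ℕ) (σ : ℝ)
    (x : ℕ → EuclideanSpace ℝ (Fin d)) : ℝ :=
  ∑ i : Fin n, ∑ j : Fin n, (laplacian σ (fun i : Fin n => x i) i j -
    Matrix.diagonal (fun i : Fin n => f (x i)) i j) ^ 2

theorem diagonal_mulVec_basisFun {ι : Type*} [Fintype ι] [DecidableEq ι] (b : ι → ℝ) (i : ι) :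
    (Matrix.diagonal b).mulVec (EuclideanSpace.basisFun ι ℝ i).ofLp =
      b i • (EuclideanSpace.basisFun ι ℝ i).ofLp := by
  ext j
  by_cases h : j = i
  · subst h; simp [Matrix.mulVec_diagonal]
  · simp [h]

/-- Comparison with the diagonal matrix with entries `f (x i)`, from above. -/
theorem eigenvalueFraction_le {d : ℕ} (f : EuclideanSpace ℝ (Fin d) → ℝ) (n : ℕ) (σ t : ℝ)
    (x : ℕ → EuclideanSpace ℝ (Fin d)) {η : ℝ} (hη : 0 < η) :
    eigenvalueFraction n σ x t ≤
      ((Finset.univ.filter fun i : Fin n => f (x i) ≤ t + η).card : ℝ) / n +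
        diagonalDefect f n σ x / n / η ^ 2 := by
  have h := card_le_card_add_frobenius (Matrix.isHermitian_diagonal fun i : Fin n => f (x i))
    (laplacian_isHermitian σ fun i : Fin n => x i).eigenvectorBasis
    (EuclideanSpace.basisFun (Fin n) ℝ) _ _
    (laplacian_isHermitian σ fun i : Fin n => x i).mulVec_eigenvectorBasis
    (diagonal_mulVec_basisFun _) t hη
  unfold eigenvalueFraction eigenvalueCount diagonalDefect
  rw [div_right_comm, ← add_div]
  gcongr

/-- Comparison with the diagonal matrix with entries `f (x i)`, from below. -/
theorem card_div_le_eigenvalueFraction_add {d : ℕ} (f : EuclideanSpace ℝ (Fin d) → ℝ) (n : ℕ)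
    (σ t : ℝ) (x : ℕ → EuclideanSpace ℝ (Fin d)) {η : ℝ} (hη : 0 < η) :
    ((Finset.univ.filter fun i : Fin n => f (x i) ≤ t - η).card : ℝ) / n ≤
      eigenvalueFraction n σ x t + diagonalDefect f n σ x / n / η ^ 2 := by
  have h := card_le_card_add_frobenius (laplacian_isHermitian σ fun i : Fin n => x i)
    (EuclideanSpace.basisFun (Fin n) ℝ)
    (laplacian_isHermitian σ fun i : Fin n => x i).eigenvectorBasis _ _
    (diagonal_mulVec_basisFun fun i : Fin n => f (x i))
    (laplacian_isHermitian σ fun i : Fin n => x i).mulVec_eigenvectorBasis (t - η) hη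
  simp only [sub_add_cancel] at h
  unfold eigenvalueFraction eigenvalueCount diagonalDefect
  rw [div_right_comm, ← add_div]
  simp_rw [sub_sq_comm (laplacian _ _ _ _)]
  gcongr

/-! ### The Gaussian kernel and the smoothed density -/

variable {d : ℕ}

theorem gaussianKernel_nonneg {v : ℝ} (hv : 0 < v) (x y : EuclideanSpace ℝ (Fin d)) :
    0 ≤ gaussianKernel v x y := by
  unfold gaussianKernel; positivity

theorem gaussianKernel_le {v : ℝ} (hv : 0 < v) (x y : EuclideanSpace ℝ (Fin d)) :
    gaussianKernel v x y ≤ 1 / (2 * Real.pi * v) ^ ((d : ℝ) / 2) := by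
  unfold gaussianKernel
  refine mul_le_of_le_one_right (by positivity) (Real.exp_le_one_iff.mpr ?_)
  rw [neg_div]
  exact neg_nonpos.mpr (by positivity)

theorem continuous_gaussianKernel (v : ℝ) :
    Continuous fun z : EuclideanSpace ℝ (Fin d) × EuclideanSpace ℝ (Fin d) =>
      gaussianKernel v z.1 z.2 := by
  unfold gaussianKernel; fun_prop

theorem integral_gaussianKernel {v : ℝ} (hv : 0 < v) (x : EuclideanSpace ℝ (Fin d)) :
    ∫ y, gaussianKernel v x y = 1 := by
  unfold gaussianKernel
  rw [integral_const_mul]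
  -- Translation and reflection move the centre of the Gaussian from `0` to `x`.
  have h := GaussianFourier.integral_rexp_neg_mul_sq_norm (V := EuclideanSpace ℝ (Fin d))
    (b := 1 / (2 * v)) (by positivity)
  rw [← integral_sub_left_eq_self _ volume x] at h
  have h2 : ∀ y : EuclideanSpace ℝ (Fin d),
      -‖x - y‖ ^ 2 / (2 * v) = -(1 / (2 * v)) * ‖x - y‖ ^ 2 := fun y => by ring
  simp_rw [h2, h, finrank_euclideanSpace_fin]
  rw [show Real.pi / (1 / (2 * v)) = 2 * Real.pi * v by field_simp]
  exact one_div_mul_cancel (by positivity)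

theorem integrable_gaussianKernel {v : ℝ} (hv : 0 < v) (x : EuclideanSpace ℝ (Fin d)) :
    Integrable (gaussianKernel v x) :=
  integrable_of_integral_eq_one (integral_gaussianKernel hv x)

/-- A first moment of the kernel is absorbed by doubling its variance, because
`r ≤ exp (r² / 4)`. -/
theorem gaussianKernel_mul_norm_le {σ : ℝ} (hσ : 0 < σ) (x y : EuclideanSpace ℝ (Fin d)) :
    gaussianKernel (σ ^ 2) x y * ‖x - y‖ ≤
      σ * 2 ^ ((d : ℝ) / 2) * gaussianKernel (2 * σ ^ 2) x y := by
  unfold gaussianKernel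
  set r := ‖x - y‖
  have h1 : r ≤ σ * Real.exp (r ^ 2 / (4 * σ ^ 2)) := by
    have := Real.add_one_le_exp (r ^ 2 / (4 * σ ^ 2))
    have h3 : r / σ ≤ r ^ 2 / (4 * σ ^ 2) + 1 := by
      have : r ^ 2 / (4 * σ ^ 2) + 1 - r / σ = (r / (2 * σ) - 1) ^ 2 := by field_simp; ring
      nlinarith [sq_nonneg (r / (2 * σ) - 1)]
    rw [mul_comm, ← div_le_iff₀ hσ]
    linarith
  have h2 : Real.exp (-r ^ 2 / (2 * (2 * σ ^ 2))) =
      Real.exp (-r ^ 2 / (2 * σ ^ 2)) * Real.exp (r ^ 2 / (4 * σ ^ 2)) := by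
    rw [← Real.exp_add]; congr 1; field_simp; ring
  have h4 : (2 * Real.pi * (2 * σ ^ 2)) ^ ((d : ℝ) / 2) =
      2 ^ ((d : ℝ) / 2) * (2 * Real.pi * σ ^ 2) ^ ((d : ℝ) / 2) := by
    rw [← Real.mul_rpow (by positivity) (by positivity)]; congr 1; ring
  rw [h2, h4]
  have hc : (0 : ℝ) < (2 * Real.pi * σ ^ 2) ^ ((d : ℝ) / 2) := by positivity
  calc _ ≤ 1 / (2 * Real.pi * σ ^ 2) ^ ((d : ℝ) / 2) * Real.exp (-r ^ 2 / (2 * σ ^ 2)) *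
        (σ * Real.exp (r ^ 2 / (4 * σ ^ 2))) := by gcongr
    _ = _ := by field_simp

theorem IsDataDensity.measurable {p : EuclideanSpace ℝ (Fin d) → ℝ} (hp : IsDataDensity p) :
    Measurable p :=
  hp.differentiable.continuous.measurable

theorem IsDataDensity.integral_densityMeasure {p : EuclideanSpace ℝ (Fin d) → ℝ}
    (hp : IsDataDensity p) (g : EuclideanSpace ℝ (Fin d) → ℝ) :
    ∫ y, g y ∂densityMeasure p = ∫ y, p y * g y := by
  unfold densityMeasure
  rw [integral_withDensity_eq_integral_toReal_smul hp.measurable.ennreal_ofReal (by simp)]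
  refine integral_congr_ae (Eventually.of_forall fun y => ?_)
  simp [ENNReal.toReal_ofReal (hp.nonneg y)]

/-- The degree function `x ↦ ∫ K_v(x, y) p(y) dy`, that is `p` smoothed by the kernel. -/
noncomputable def smoothedDensity (p : EuclideanSpace ℝ (Fin d) → ℝ) (v : ℝ)
    (x : EuclideanSpace ℝ (Fin d)) : ℝ :=
  ∫ y, gaussianKernel v x y ∂densityMeasure p

theorem IsDataDensity.integrable_mul_gaussianKernel {p : EuclideanSpace ℝ (Fin d) → ℝ}
    (hp : IsDataDensity p) {v : ℝ} (hv : 0 < v) (x : EuclideanSpace ℝ (Fin d)) :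
    Integrable fun y => p y * gaussianKernel v x y := by
  obtain ⟨M, hM⟩ := hp.bounded
  refine (integrable_gaussianKernel hv x).bdd_mul (c := M)
    hp.measurable.aestronglyMeasurable (Eventually.of_forall fun y => ?_)
  rw [Real.norm_eq_abs, abs_of_nonneg (hp.nonneg y)]
  exact hM y

theorem smoothedDensity_nonneg (p : EuclideanSpace ℝ (Fin d) → ℝ) {v : ℝ} (hv : 0 < v)
    (x : EuclideanSpace ℝ (Fin d)) : 0 ≤ smoothedDensity p v x :=
  integral_nonneg fun y => gaussianKernel_nonneg hv x y

theorem IsDataDensity.smoothedDensity_le {p : EuclideanSpace ℝ (Fin d) → ℝ}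
    (hp : IsDataDensity p) {M : ℝ} (hM : ∀ x, p x ≤ M) {v : ℝ} (hv : 0 < v)
    (x : EuclideanSpace ℝ (Fin d)) : smoothedDensity p v x ≤ M := by
  unfold smoothedDensity
  rw [hp.integral_densityMeasure]
  calc ∫ y, p y * gaussianKernel v x y ≤ ∫ y, M * gaussianKernel v x y := by
        refine integral_mono (hp.integrable_mul_gaussianKernel hv x)
          ((integrable_gaussianKernel hv x).const_mul M) fun y => ?_
        exact mul_le_mul_of_nonneg_right (hM y) (gaussianKernel_nonneg hv x y)
    _ = M := by rw [integral_const_mul, integral_gaussianKernel hv, mul_one]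

/-- The bias of the kernel density estimator is `O(σ)` uniformly, as `p` is Lipschitz. -/
theorem IsDataDensity.abs_smoothedDensity_sub_le {p : EuclideanSpace ℝ (Fin d) → ℝ}
    (hp : IsDataDensity p) {C : NNReal} (hC : LipschitzWith C p) {σ : ℝ} (hσ : 0 < σ)
    (x : EuclideanSpace ℝ (Fin d)) :
    |smoothedDensity p (σ ^ 2) x - p x| ≤ C * 2 ^ ((d : ℝ) / 2) * σ := by
  have hv : 0 < σ ^ 2 := by positivity
  have h1 : smoothedDensity p (σ ^ 2) x - p x =
      ∫ y, (p y - p x) * gaussianKernel (σ ^ 2) x y := by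
    unfold smoothedDensity
    simp_rw [hp.integral_densityMeasure, sub_mul]
    rw [integral_sub (hp.integrable_mul_gaussianKernel hv x)
      ((integrable_gaussianKernel hv x).const_mul _), integral_const_mul,
      integral_gaussianKernel hv, mul_one]
  rw [h1, ← Real.norm_eq_abs]
  calc _ ≤ ∫ y, C * (σ * 2 ^ ((d : ℝ) / 2)) * gaussianKernel (2 * σ ^ 2) x y := by
        refine norm_integral_le_of_norm_le
          ((integrable_gaussianKernel (by positivity) x).const_mul _)
          (Eventually.of_forall fun y => ?_)
        rw [norm_mul, Real.norm_of_nonneg (gaussianKernel_nonneg hv x y)]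
        have h2 := hC.dist_le_mul y x
        rw [dist_eq_norm, dist_eq_norm, norm_sub_rev y x] at h2
        calc _ ≤ C * ‖x - y‖ * gaussianKernel (σ ^ 2) x y :=
              mul_le_mul_of_nonneg_right h2 (gaussianKernel_nonneg hv x y)
          _ = C * (gaussianKernel (σ ^ 2) x y * ‖x - y‖) := by ring
          _ ≤ C * (σ * 2 ^ ((d : ℝ) / 2) * gaussianKernel (2 * σ ^ 2) x y) :=
              mul_le_mul_of_nonneg_left (gaussianKernel_mul_norm_le hσ x y) C.2
          _ = _ := by ring
    _ = _ := by
        rw [integral_const_mul, integral_gaussianKernel (by positivity)]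
        ring

/-! ### Second moments for independent samples -/

section Sampling

variable {S Ω : Type*} [MeasurableSpace S] [MeasurableSpace Ω] {μ : Measure Ω}
  [IsProbabilityMeasure μ] {P : Measure S} {X : ℕ → Ω → S}

theorem integrable_of_abs_le_const {T : Type*} [MeasurableSpace T] {ν : Measure T}
    [IsFiniteMeasure ν] {f : T → ℝ} (hf : Measurable f) {C : ℝ} (hC : ∀ x, |f x| ≤ C) :
    Integrable f ν :=
  Integrable.of_bound hf.aestronglyMeasurable C (Eventually.of_forall hC)

theorem measurable_comp_sequence {T : Type*} [MeasurableSpace T] {F : (ℕ → S) → T}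
    (hF : Measurable F) (hX : ∀ i, Measurable (X i)) : Measurable fun ω => F fun i => X i ω := by
  have hXm : Measurable fun ω i => X i ω := measurable_pi_lambda _ hX
  exact hF.comp hXm

theorem map_prodMk_eq_prod (hX : ∀ i, Measurable (X i)) (hindep : iIndepFun X μ)
    (hlaw : ∀ i, μ.map (X i) = P) {i j : ℕ} (hij : i ≠ j) :
    μ.map (fun ω => (X i ω, X j ω)) = P.prod P := by
  have := (indepFun_iff_map_prod_eq_prod_map_map (hX i).aemeasurable (hX j).aemeasurable).mp
    (hindep.indepFun hij)
  rw [this, hlaw, hlaw]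

theorem map_prodMk_prodMk_eq_prod [IsProbabilityMeasure P] (hX : ∀ i, Measurable (X i)) (hindep : iIndepFun X μ)
    (hlaw : ∀ i, μ.map (X i) = P) {i j k : ℕ} (hij : i ≠ j) (hik : i ≠ k) (hjk : j ≠ k) :
    μ.map (fun ω => ((X i ω, X j ω), X k ω)) = (P.prod P).prod P := by
  have := (indepFun_iff_map_prod_eq_prod_map_map ((hX i).prodMk (hX j)).aemeasurable
    (hX k).aemeasurable).mp (hindep.indepFun_prodMk hX i j k hik hjk)
  rw [this, hlaw, map_prodMk_eq_prod hX hindep hlaw hij]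

/-- For a kernel centred in its second argument, the summands of an empirical average
conditional on `X i` are uncorrelated. -/
theorem integral_mul_eq_zero_of_centred [IsProbabilityMeasure P] (hX : ∀ i, Measurable (X i)) (hindep : iIndepFun X μ)
    (hlaw : ∀ i, μ.map (X i) = P) {h : S → S → ℝ} (hm : Measurable fun z : S × S => h z.1 z.2)
    {C : ℝ} (hC : ∀ x y, |h x y| ≤ C) (h0 : ∀ x, ∫ y, h x y ∂P = 0)
    {i j k : ℕ} (hij : i ≠ j) (hik : i ≠ k) (hjk : j ≠ k) :
    ∫ ω, h (X i ω) (X j ω) * h (X i ω) (X k ω) ∂μ = 0 := by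
  have hg : Measurable fun z : (S × S) × S => h z.1.1 z.1.2 * h z.1.1 z.2 :=
    (hm.comp measurable_fst).mul (hm.comp (measurable_fst.fst.prodMk measurable_snd))
  have h1 : ∫ ω, h (X i ω) (X j ω) * h (X i ω) (X k ω) ∂μ =
      ∫ z, h z.1.1 z.1.2 * h z.1.1 z.2 ∂((P.prod P).prod P) := by
    rw [← map_prodMk_prodMk_eq_prod hX hindep hlaw hij hik hjk,
      integral_map (((hX i).prodMk (hX j)).prodMk (hX k)).aemeasurable hg.aestronglyMeasurable]
  rw [h1, integral_prod]
  · simp [integral_const_mul, h0]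
  · refine integrable_of_abs_le_const hg (C := C * C) fun z => ?_
    rw [abs_mul]
    exact mul_le_mul (hC _ _) (hC _ _) (abs_nonneg _) ((abs_nonneg _).trans (hC z.1.1 z.1.2))

theorem integral_sq_le_of_integral_le [IsProbabilityMeasure P] (hX : ∀ i, Measurable (X i)) (hindep : iIndepFun X μ)
    (hlaw : ∀ i, μ.map (X i) = P) {k : S → S → ℝ} (hm : Measurable fun z : S × S => k z.1 z.2)
    {B M : ℝ} (hk0 : ∀ x y, 0 ≤ k x y) (hkB : ∀ x y, k x y ≤ B) (hB : 0 ≤ B)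
    (hM : ∀ x, ∫ y, k x y ∂P ≤ M) {i j : ℕ} (hij : i ≠ j) :
    ∫ ω, k (X i ω) (X j ω) ^ 2 ∂μ ≤ B * M := by
  have hk : ∀ x y, |k x y| ≤ B := fun x y => by rw [abs_of_nonneg (hk0 x y)]; exact hkB x y
  have hint : Integrable (fun z : S × S => k z.1 z.2) (P.prod P) :=
    integrable_of_abs_le_const hm fun z => hk z.1 z.2
  have h1 : ∫ ω, k (X i ω) (X j ω) ^ 2 ∂μ = ∫ z, k z.1 z.2 ^ 2 ∂(P.prod P) := by
    rw [← map_prodMk_eq_prod hX hindep hlaw hij,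
      integral_map ((hX i).prodMk (hX j)).aemeasurable (hm.pow_const 2).aestronglyMeasurable]
  have h2 : ∫ z, k z.1 z.2 ^ 2 ∂(P.prod P) ≤ ∫ z, B * k z.1 z.2 ∂(P.prod P) := by
    refine integral_mono ?_ (hint.const_mul B) fun z => ?_
    · refine integrable_of_abs_le_const (hm.pow_const 2) (C := B ^ 2) fun z => ?_
      rw [abs_pow]
      exact pow_le_pow_left₀ (abs_nonneg _) (hk _ _) 2
    · simp only [sq]
      exact mul_le_mul_of_nonneg_right (hkB _ _) (hk0 _ _)
  have h3 : ∫ z, k z.1 z.2 ∂(P.prod P) ≤ M := by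
    rw [integral_prod _ hint]
    calc _ ≤ ∫ _x, M ∂P := integral_mono hint.integral_prod_left (integrable_const M) hM
      _ = M := by simp
  rw [h1]
  refine h2.trans ?_
  rw [integral_const_mul]
  exact mul_le_mul_of_nonneg_left h3 hB

/-- Variance bound for the empirical degree of vertex `i`, centred at its conditional mean. -/
theorem integral_sq_sum_sub_le [IsProbabilityMeasure P] (hX : ∀ i, Measurable (X i)) (hindep : iIndepFun X μ)
    (hlaw : ∀ i, μ.map (X i) = P) {k : S → S → ℝ} (hm : Measurable fun z : S × S => k z.1 z.2)
    {B M : ℝ} (hk0 : ∀ x y, 0 ≤ k x y) (hkB : ∀ x y, k x y ≤ B) (hB : 0 ≤ B)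
    (hM : ∀ x, ∫ y, k x y ∂P ≤ M) (n : ℕ) (i : Fin n) :
    Integrable (fun ω => (∑ j ∈ Finset.univ.erase i,
      (k (X i ω) (X j ω) - ∫ y, k (X i ω) y ∂P)) ^ 2) μ ∧
    ∫ ω, (∑ j ∈ Finset.univ.erase i, (k (X i ω) (X j ω) - ∫ y, k (X i ω) y ∂P)) ^ 2 ∂μ ≤
      n * (2 * (B * M)) := by
  set q : S → ℝ := fun x => ∫ y, k x y ∂P with hq
  set h : S → S → ℝ := fun x y => k x y - q x with hh
  have hk : ∀ x y, |k x y| ≤ B := fun x y => by rw [abs_of_nonneg (hk0 x y)]; exact hkB x y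
  have hkint : ∀ x, Integrable (k x) P := fun x =>
    integrable_of_abs_le_const (hm.comp measurable_prodMk_left) (hk x)
  have hq0 : ∀ x, 0 ≤ q x := fun x => integral_nonneg (hk0 x)
  have hqB : ∀ x, q x ≤ B := fun x => by
    calc _ ≤ ∫ _y, B ∂P := integral_mono (hkint x) (integrable_const B) (hkB x)
      _ = B := by simp
  have hqm : Measurable q := hm.stronglyMeasurable.integral_prod_right.measurable
  have hhm : Measurable fun z : S × S => h z.1 z.2 := hm.sub (hqm.comp measurable_fst)
  have hhB : ∀ x y, |h x y| ≤ B := fun x y => by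
    rw [abs_le]
    constructor <;> simp only [hh] <;> linarith [hk0 x y, hkB x y, hq0 x, hqB x]
  have hh0 : ∀ x, ∫ y, h x y ∂P = 0 := fun x => by
    simp only [hh]
    rw [integral_sub (hkint x) (integrable_const _)]
    simp [hq]
  have hhX : ∀ j : Fin n, Measurable fun ω => h (X i ω) (X j ω) := fun j =>
    hhm.comp ((hX i).prodMk (hX j))
  have hprod : ∀ j l : Fin n, Integrable (fun ω => h (X i ω) (X j ω) * h (X i ω) (X l ω)) μ :=
    fun j l => integrable_of_abs_le_const ((hhX j).mul (hhX l)) (C := B * B) fun ω => by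
      rw [abs_mul]; exact mul_le_mul (hhB _ _) (hhB _ _) (abs_nonneg _) hB
  have hexp : ∀ ω, (∑ j ∈ Finset.univ.erase i, h (X i ω) (X j ω)) ^ 2 =
      ∑ j ∈ Finset.univ.erase i, ∑ l ∈ Finset.univ.erase i,
        h (X i ω) (X j ω) * h (X i ω) (X l ω) := fun ω => by
    rw [sq, Finset.sum_mul_sum]
  change Integrable (fun ω => (∑ j ∈ Finset.univ.erase i, h (X i ω) (X j ω)) ^ 2) μ ∧
    ∫ ω, (∑ j ∈ Finset.univ.erase i, h (X i ω) (X j ω)) ^ 2 ∂μ ≤ n * (2 * (B * M))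
  simp_rw [hexp]
  refine ⟨integrable_finsetSum _ fun j _ => integrable_finsetSum _ fun l _ => hprod j l, ?_⟩
  rw [integral_finsetSum _ fun j _ => integrable_finsetSum _ fun l _ => hprod j l]
  have hM0 : 0 ≤ B * M := by
    obtain ⟨x⟩ := nonempty_of_isProbabilityMeasure P
    exact mul_nonneg hB ((hq0 x).trans (hM x))
  -- Only the diagonal terms survive, and `(k - q)² ≤ k² + q²`.
  have hrow : ∀ j ∈ Finset.univ.erase i, ∫ ω, ∑ l ∈ Finset.univ.erase i,
      h (X i ω) (X j ω) * h (X i ω) (X l ω) ∂μ ≤ 2 * (B * M) := by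
    intro j hj
    have hij : (i : ℕ) ≠ j := fun e => Finset.ne_of_mem_erase hj (Fin.ext e).symm
    rw [integral_finsetSum _ fun l _ => hprod j l, Finset.sum_eq_single_of_mem j hj]
    · have hk2 : Integrable (fun ω => k (X i ω) (X j ω) ^ 2) μ :=
        integrable_of_abs_le_const ((hm.comp ((hX i).prodMk (hX j))).pow_const 2) (C := B ^ 2)
          fun ω => by rw [abs_pow]; exact pow_le_pow_left₀ (abs_nonneg _) (hk _ _) 2
      calc _ ≤ ∫ ω, (k (X i ω) (X j ω) ^ 2 + B * M) ∂μ := by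
            refine integral_mono (hprod j j) (hk2.add (integrable_const _)) fun ω => ?_
            have h1 : q (X i ω) ^ 2 ≤ B * M := by
              rw [sq]; exact mul_le_mul (hqB _) (hM _) (hq0 _) hB
            have h2 := mul_nonneg (hk0 (X i ω) (X j ω)) (hq0 (X i ω))
            simp only [hh]
            nlinarith
        _ ≤ 2 * (B * M) := by
            rw [integral_add hk2 (integrable_const _)]
            have := integral_sq_le_of_integral_le hX hindep hlaw hm hk0 hkB hB hM hij
            simp only [integral_const, probReal_univ, one_smul]
            linarith
    · intro l hl hlj
      exact integral_mul_eq_zero_of_centred hX hindep hlaw hhm hhB hh0 hij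
        (fun e => Finset.ne_of_mem_erase hl (Fin.ext e).symm) (fun e => hlj (Fin.ext e).symm)
  refine (Finset.sum_le_card_nsmul _ _ _ hrow).trans ?_
  rw [nsmul_eq_mul]
  refine mul_le_mul_of_nonneg_right ?_ (by positivity)
  have := Finset.card_erase_le (a := i) (s := (Finset.univ : Finset (Fin n)))
  rw [Finset.card_fin] at this
  exact_mod_cast this

/-- Mean of the bound for one row of `L - diag(p(X_i))`: the conditional variance of the degree,
a deterministic term `c` for its bias, and the off-diagonal weights. -/
theorem integral_row_bound_le [IsProbabilityMeasure P] (hX : ∀ i, Measurable (X i))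
    (hindep : iIndepFun X μ) (hlaw : ∀ i, μ.map (X i) = P) {k : S → S → ℝ}
    (hm : Measurable fun z : S × S => k z.1 z.2) {B M : ℝ} (hk0 : ∀ x y, 0 ≤ k x y)
    (hkB : ∀ x y, k x y ≤ B) (hB : 0 ≤ B) (hM0 : 0 ≤ M) {q : S → ℝ}
    (hq : ∀ x, q x = ∫ y, k x y ∂P) (hM : ∀ x, q x ≤ M) (c : ℝ) {n : ℕ} (i : Fin n) :
    Integrable (fun ω => 2 / (n : ℝ) ^ 2 *
      (∑ j ∈ Finset.univ.erase i, (k (X i ω) (X j ω) - q (X i ω))) ^ 2 + c +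
      1 / (n : ℝ) ^ 2 * ∑ j ∈ Finset.univ.erase i, k (X i ω) (X j ω) ^ 2) μ ∧
    ∫ ω, (2 / (n : ℝ) ^ 2 *
      (∑ j ∈ Finset.univ.erase i, (k (X i ω) (X j ω) - q (X i ω))) ^ 2 + c +
      1 / (n : ℝ) ^ 2 * ∑ j ∈ Finset.univ.erase i, k (X i ω) (X j ω) ^ 2) ∂μ ≤
      5 * (B * M) / n + c := by
  have hn' : (0 : ℝ) < n := by exact_mod_cast i.pos
  have hM' : ∀ x, ∫ y, k x y ∂P ≤ M := fun x => hq x ▸ hM x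
  have hfluct := integral_sq_sum_sub_le hX hindep hlaw hm hk0 hkB hB hM' n i
  simp_rw [← hq] at hfluct
  have hkint : ∀ j : Fin n, Integrable (fun ω => k (X i ω) (X j ω) ^ 2) μ := fun j =>
    integrable_of_abs_le_const ((hm.comp ((hX i).prodMk (hX j))).pow_const 2) (C := B ^ 2)
      fun ω => by
        rw [abs_pow, abs_of_nonneg (hk0 _ _)]
        exact pow_le_pow_left₀ (hk0 _ _) (hkB _ _) 2
  have hsum : ∫ ω, ∑ j ∈ Finset.univ.erase i, k (X i ω) (X j ω) ^ 2 ∂μ ≤ n * (B * M) := by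
    rw [integral_finsetSum _ fun j _ => hkint j]
    refine (Finset.sum_le_card_nsmul _ _ (B * M) fun j hj => ?_).trans ?_
    · exact integral_sq_le_of_integral_le hX hindep hlaw hm hk0 hkB hB hM'
        fun h => Finset.ne_of_mem_erase hj (Fin.ext h).symm
    · rw [nsmul_eq_mul]
      refine mul_le_mul_of_nonneg_right ?_ (by positivity)
      have := Finset.card_erase_le (a := i) (s := (Finset.univ : Finset (Fin n)))
      rw [Finset.card_fin] at this
      exact_mod_cast this
  have hsumint : Integrable (fun ω => 1 / (n : ℝ) ^ 2 *
      ∑ j ∈ Finset.univ.erase i, k (X i ω) (X j ω) ^ 2) μ :=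
    (integrable_finsetSum _ fun j _ => hkint j).const_mul _
  have hfint := hfluct.1.const_mul (2 / (n : ℝ) ^ 2)
  have hc : Integrable (fun _ : Ω => c) μ := integrable_const c
  have hfc : Integrable (fun ω => 2 / (n : ℝ) ^ 2 *
      (∑ j ∈ Finset.univ.erase i, (k (X i ω) (X j ω) - q (X i ω))) ^ 2 + c) μ := hfint.add hc
  refine ⟨hfc.add hsumint, ?_⟩
  rw [integral_add hfc hsumint, integral_add hfint hc, integral_const_mul,
    integral_const_mul]
  simp only [integral_const, probReal_univ, one_smul]
  calc _ ≤ 2 / (n : ℝ) ^ 2 * (n * (2 * (B * M))) + c + 1 / (n : ℝ) ^ 2 * (n * (B * M)) := by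
        gcongr
        exact hfluct.2
    _ = _ := by field_simp; ring

theorem integral_card_filter_div (hX : ∀ i, Measurable (X i))
    (hlaw : ∀ i, μ.map (X i) = P) {f : S → ℝ} (hf : Measurable f) (s : ℝ) {n : ℕ} (hn : 0 < n) :
    Integrable (fun ω => ((Finset.univ.filter fun i : Fin n => f (X i ω) ≤ s).card : ℝ) / n) μ ∧
    ∫ ω, ((Finset.univ.filter fun i : Fin n => f (X i ω) ≤ s).card : ℝ) / n ∂μ =
      P.real {x | f x ≤ s} := by
  have hA : MeasurableSet {x | f x ≤ s} := hf measurableSet_Iic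
  have h1 : ∀ ω, ((Finset.univ.filter fun i : Fin n => f (X i ω) ≤ s).card : ℝ) =
      ∑ i : Fin n, (X i ⁻¹' {x | f x ≤ s}).indicator (fun _ => (1 : ℝ)) ω := by
    intro ω
    rw [Finset.card_filter]
    push_cast
    exact Finset.sum_congr rfl fun i _ => by simp [Set.indicator]
  have h2 : ∀ i : Fin n, Integrable ((X i ⁻¹' {x | f x ≤ s}).indicator fun _ => (1 : ℝ)) μ :=
    fun i => (integrable_const 1).indicator (hX i hA)
  simp_rw [h1]
  refine ⟨(integrable_finsetSum _ fun i _ => h2 i).div_const _, ?_⟩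
  rw [integral_div, integral_finsetSum _ fun i _ => h2 i]
  have h3 : ∀ i : Fin n, ∫ ω, (X i ⁻¹' {x | f x ≤ s}).indicator (fun _ => (1 : ℝ)) ω ∂μ =
      P.real {x | f x ≤ s} := fun i => by
    rw [integral_indicator_const _ (hX i hA), smul_eq_mul, mul_one, ← hlaw i,
      map_measureReal_apply (hX i) hA]
  simp_rw [h3]
  have : (n : ℝ) ≠ 0 := by positivity
  simp [this]

end Sampling

/-! ### The Laplacian is nearly diagonal -/

section Comparison

theorem laplacian_apply_of_ne {n : ℕ} (σ : ℝ) (x : Fin n → EuclideanSpace ℝ (Fin d))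
    {i j : Fin n} (h : i ≠ j) :
    laplacian σ x i j = -(gaussianKernel (σ ^ 2) (x i) (x j) / n) := by
  simp [laplacian, degreeMatrix, weightMatrix, h]
  ring

theorem laplacian_apply_self {n : ℕ} (σ : ℝ) (x : Fin n → EuclideanSpace ℝ (Fin d)) (i : Fin n) :
    laplacian σ x i i = (∑ j ∈ Finset.univ.erase i, gaussianKernel (σ ^ 2) (x i) (x j)) / n := by
  have h : ∑ j, weightMatrix σ x i j =
      ∑ j ∈ Finset.univ.erase i, gaussianKernel (σ ^ 2) (x i) (x j) := by
    rw [← Finset.add_sum_erase _ _ (Finset.mem_univ i)]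
    simp only [weightMatrix, Matrix.of_apply, if_true, zero_add]
    exact Finset.sum_congr rfl fun j hj => if_neg (Finset.ne_of_mem_erase hj).symm
  simp only [laplacian, degreeMatrix, Matrix.smul_apply, Matrix.sub_apply,
    Matrix.diagonal_apply_eq, smul_eq_mul, h]
  simp [weightMatrix]
  ring

/-- Splits the defect of row `i` into the fluctuation of the empirical degree, its bias, and the
off-diagonal weights. -/
theorem sum_laplacian_sub_diagonal_sq_le {p : EuclideanSpace ℝ (Fin d) → ℝ} {n : ℕ} (hn : 0 < n)
    {σ e M : ℝ} {q : EuclideanSpace ℝ (Fin d) → ℝ} (hq0 : ∀ x, 0 ≤ q x) (hqM : ∀ x, q x ≤ M)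
    (hqe : ∀ x, |q x - p x| ≤ e) (x : ℕ → EuclideanSpace ℝ (Fin d)) (i : Fin n) :
    ∑ j : Fin n, (laplacian σ (fun i : Fin n => x i) i j -
        Matrix.diagonal (fun i : Fin n => p (x i)) i j) ^ 2 ≤
      2 / (n : ℝ) ^ 2 * (∑ j ∈ Finset.univ.erase i,
        (gaussianKernel (σ ^ 2) (x i) (x j) - q (x i))) ^ 2 + 2 * (e + M / n) ^ 2 +
      1 / (n : ℝ) ^ 2 * ∑ j ∈ Finset.univ.erase i, gaussianKernel (σ ^ 2) (x i) (x j) ^ 2 := by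
  have hn' : (0 : ℝ) < n := by positivity
  rw [← Finset.add_sum_erase _ _ (Finset.mem_univ i)]
  refine add_le_add ?_ (le_of_eq ?_)
  · rw [laplacian_apply_self, Matrix.diagonal_apply_eq]
    set T := ∑ j ∈ Finset.univ.erase i, (gaussianKernel (σ ^ 2) (x i) (x j) - q (x i)) with hT
    -- The degree has `n - 1` summands but is divided by `n`: this is the source of `M / n`.
    have h1 : ∑ j ∈ Finset.univ.erase i, gaussianKernel (σ ^ 2) (x i) (x j) =
        T + (n - 1) * q (x i) := by
      rw [hT, Finset.sum_sub_distrib, Finset.sum_const, Finset.card_erase_of_mem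
        (Finset.mem_univ i), Finset.card_fin, nsmul_eq_mul, Nat.cast_pred hn]
      ring
    have h2 : (∑ j ∈ Finset.univ.erase i, gaussianKernel (σ ^ 2) (x i) (x j)) / n - p (x i) =
        T / n + (q (x i) - p (x i) - q (x i) / n) := by
      rw [h1]; field_simp; ring
    have h3 : (q (x i) - p (x i) - q (x i) / n) ^ 2 ≤ (e + M / n) ^ 2 := by
      refine sq_le_sq' ?_ ?_
      all_goals
        have h4 := abs_le.mp (hqe (x i))
        have h5 : q (x i) / n ≤ M / n := by gcongr; exact hqM _
        have h6 : 0 ≤ q (x i) / n := div_nonneg (hq0 _) hn'.le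
        linarith
    rw [h2]
    have h7 : 2 / (n : ℝ) ^ 2 * T ^ 2 = 2 * (T / n) ^ 2 := by ring
    rw [h7]
    nlinarith [sq_nonneg (T / n - (q (x i) - p (x i) - q (x i) / n))]
  · rw [Finset.mul_sum]
    refine Finset.sum_congr rfl fun j hj => ?_
    have hij := (Finset.ne_of_mem_erase hj).symm
    rw [laplacian_apply_of_ne _ _ hij, Matrix.diagonal_apply_ne _ hij]
    ring

theorem measurable_diagonalDefect {p : EuclideanSpace ℝ (Fin d) → ℝ} (hp : Measurable p)
    (n : ℕ) (σ : ℝ) : Measurable (diagonalDefect p n σ) := by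
  refine Finset.measurable_sum _ fun i _ => Finset.measurable_sum _ fun j _ => ?_
  have h1 : Measurable fun x : ℕ → EuclideanSpace ℝ (Fin d) =>
      laplacian σ (fun i : Fin n => x i) i j :=
    ((continuous_laplacian σ).matrix_elem i j).measurable.comp (by fun_prop)
  have h2 : Measurable fun x : ℕ → EuclideanSpace ℝ (Fin d) =>
      Matrix.diagonal (fun i : Fin n => p (x i)) i j := by
    by_cases h : i = j
    · subst h; simp only [Matrix.diagonal_apply_eq]; fun_prop
    · simp only [Matrix.diagonal_apply_ne _ h]; fun_prop
  exact (h1.sub h2).pow_const 2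

theorem diagonalDefect_nonneg (p : EuclideanSpace ℝ (Fin d) → ℝ) (n : ℕ) (σ : ℝ)
    (x : ℕ → EuclideanSpace ℝ (Fin d)) : 0 ≤ diagonalDefect p n σ x := by
  unfold diagonalDefect; positivity

variable {Ω : Type*} [MeasurableSpace Ω] {μ : Measure Ω} [IsProbabilityMeasure μ]
  {X : ℕ → Ω → EuclideanSpace ℝ (Fin d)}

/-- The mean of the normalised defect is `O(1 / (n σ^d)) + O((σ + 1 / n)²)`. -/
theorem integral_diagonalDefect_div_le {p : EuclideanSpace ℝ (Fin d) → ℝ} (hp : IsDataDensity p)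
    (hX : ∀ i, Measurable (X i)) (hindep : iIndepFun X μ)
    (hlaw : ∀ i, μ.map (X i) = densityMeasure p) {M : ℝ} (hM : ∀ x, p x ≤ M)
    {C : NNReal} (hC : LipschitzWith C p) {n : ℕ} (hn : 0 < n) {σ : ℝ} (hσ : 0 < σ) :
    Integrable (fun ω => diagonalDefect p n σ (fun i => X i ω) / n) μ ∧
    ∫ ω, diagonalDefect p n σ (fun i => X i ω) / n ∂μ ≤
      5 * (1 / (2 * Real.pi * σ ^ 2) ^ ((d : ℝ) / 2) * M) / n +
        2 * (C * 2 ^ ((d : ℝ) / 2) * σ + M / n) ^ 2 := by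
  have hP : IsProbabilityMeasure (densityMeasure p) :=
    hlaw 0 ▸ Measure.isProbabilityMeasure_map (hX 0).aemeasurable
  have hv : 0 < σ ^ 2 := by positivity
  have hn' : (0 : ℝ) < n := by positivity
  set B : ℝ := 1 / (2 * Real.pi * σ ^ 2) ^ ((d : ℝ) / 2)
  set e : ℝ := C * 2 ^ ((d : ℝ) / 2) * σ
  have hB : 0 ≤ B := by positivity
  have hm := (continuous_gaussianKernel (d := d) (σ ^ 2)).measurable
  have hk0 := gaussianKernel_nonneg (d := d) hv
  have hkB := gaussianKernel_le (d := d) hv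
  have hqM := hp.smoothedDensity_le hM hv
  have hrow := integral_row_bound_le hX hindep hlaw hm hk0 hkB hB ((hp.nonneg 0).trans (hM 0))
    (q := smoothedDensity p (σ ^ 2)) (fun x => rfl) hqM (2 * (e + M / n) ^ 2) (n := n)
  -- The bound and the row bounds `G` are made opaque, to keep unification cheap below.
  generalize hbound : 5 * (B * M) / n + 2 * (e + M / n) ^ 2 = bound at hrow ⊢
  choose hGint hGle using hrow
  have hpw := fun ω => sum_laplacian_sub_diagonal_sq_le (σ := σ) hn (smoothedDensity_nonneg p hv) hqM
    (hp.abs_smoothedDensity_sub_le hC hσ) (fun i => X i ω)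
  set G : Fin n → Ω → ℝ := fun i ω => 2 / (n : ℝ) ^ 2 * (∑ j ∈ Finset.univ.erase i,
        (gaussianKernel (σ ^ 2) (X i ω) (X j ω) - smoothedDensity p (σ ^ 2) (X i ω))) ^ 2 +
      2 * (e + M / n) ^ 2 +
      1 / (n : ℝ) ^ 2 * ∑ j ∈ Finset.univ.erase i, gaussianKernel (σ ^ 2) (X i ω) (X j ω) ^ 2
  replace hGint : ∀ i, Integrable (G i) μ := hGint
  replace hGle : ∀ i, ∫ ω, G i ω ∂μ ≤ bound := hGle
  replace hpw : ∀ ω i, ∑ j : Fin n, (laplacian σ (fun i : Fin n => X i ω) i j -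
      Matrix.diagonal (fun i : Fin n => p (X i ω)) i j) ^ 2 ≤ G i ω := hpw
  clear_value G
  have hle : ∀ ω, diagonalDefect p n σ (fun i => X i ω) / n ≤ (∑ i, G i ω) / n := fun ω => by
    unfold diagonalDefect
    gcongr with i
    exact hpw ω i
  have hsG : Integrable (fun ω => (∑ i, G i ω) / n) μ :=
    (integrable_finsetSum _ fun i _ => hGint i).div_const _
  have hmeas : Measurable fun ω => diagonalDefect p n σ (fun i => X i ω) / n :=
    (measurable_comp_sequence (measurable_diagonalDefect hp.measurable n σ) hX).div_const _
  have hint : Integrable (fun ω => diagonalDefect p n σ (fun i => X i ω) / n) μ := by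
    refine hsG.mono' hmeas.aestronglyMeasurable (Eventually.of_forall fun ω => ?_)
    rw [Real.norm_of_nonneg (div_nonneg (diagonalDefect_nonneg p n σ _) hn'.le)]
    exact hle ω
  refine ⟨hint, (integral_mono hint hsG hle).trans ?_⟩
  rw [integral_div, integral_finsetSum _ fun i _ => hGint i, div_le_iff₀ hn']
  refine (Finset.sum_le_card_nsmul _ _ _ fun i _ => hGle i).trans ?_
  rw [Finset.card_fin, nsmul_eq_mul, mul_comm]

theorem integrable_eigenvalueFraction (hX : ∀ i, Measurable (X i)) (n : ℕ) (σ t : ℝ) :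
    Integrable (fun ω => eigenvalueFraction n σ (fun i => X i ω) t) μ := by
  have hm := measurable_comp_sequence (measurable_eigenvalueFraction (d := d) n σ t) hX
  refine integrable_of_abs_le_const (C := 1) hm fun ω => ?_
  rw [abs_of_nonneg (eigenvalueFraction_nonneg n σ t _)]
  exact eigenvalueFraction_le_one n σ t _

/-! ### Convergence of the expected eigenvalue fraction -/

/-- If `t` is not an atom of the law of `f` then `s ↦ ν {f ≤ s}` is continuous at `t`. -/
theorem continuousAt_measureReal_le {S : Type*} [MeasurableSpace S] {ν : Measure S}
    [IsProbabilityMeasure ν] {f : S → ℝ} (hf : Measurable f) {t : ℝ} (ht : ν {x | f x = t} = 0) :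
    ContinuousAt (fun s => ν.real {x | f x ≤ s}) t := by
  have hprob := Measure.isProbabilityMeasure_map (μ := ν) hf.aemeasurable
  have h1 : (fun s => ν.real {x | f x ≤ s}) = cdf (ν.map f) := by
    ext s
    rw [cdf_eq_real, map_measureReal_apply hf measurableSet_Iic]
    rfl
  have h2 : (ν.map f) {t} = 0 := by
    rw [Measure.map_apply hf (measurableSet_singleton t)]
    exact ht
  rw [h1, (cdf (ν.map f)).mono.continuousAt_iff_leftLim_eq_rightLim,
    StieltjesFunction.rightLim_eq]
  rw [← measure_cdf (ν.map f), StieltjesFunction.measure_singleton,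
    ENNReal.ofReal_eq_zero] at h2
  exact le_antisymm ((cdf (ν.map f)).mono.leftLim_le le_rfl) (by linarith)

/-- The expected eigenvalue fraction is close to `P(p ≤ t)` as soon as both error parameters
`1 / (n σ^d)` and `σ + 1 / n` are small. -/
theorem exists_forall_abs_integral_eigenvalueFraction_sub_lt
    {p : EuclideanSpace ℝ (Fin d) → ℝ} (hp : IsDataDensity p)
    (hX : ∀ i, Measurable (X i)) (hindep : iIndepFun X μ)
    (hlaw : ∀ i, μ.map (X i) = densityMeasure p) {t : ℝ}
    (ht : densityMeasure p {x | p x = t} = 0) {M : ℝ} (hM : ∀ x, p x ≤ M)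
    {C : NNReal} (hC : LipschitzWith C p) {ε : ℝ} (hε : 0 < ε) :
    ∃ δ : ℝ, 0 < δ ∧ ∀ n : ℕ, 0 < n → ∀ σ : ℝ, 0 < σ →
      5 * (1 / (2 * Real.pi * σ ^ 2) ^ ((d : ℝ) / 2) * M) / n +
        2 * (C * 2 ^ ((d : ℝ) / 2) * σ + M / n) ^ 2 < δ →
      |∫ ω, eigenvalueFraction n σ (fun i => X i ω) t ∂μ -
        (densityMeasure p).real {x | p x ≤ t}| < ε := by
  have hP : IsProbabilityMeasure (densityMeasure p) :=
    hlaw 0 ▸ Measure.isProbabilityMeasure_map (hX 0).aemeasurable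
  obtain ⟨r, hr, hcont⟩ := Metric.continuousAt_iff.mp
    (continuousAt_measureReal_le hp.measurable ht) (ε / 2) (by positivity)
  set η := r / 2 with hη_def
  have hη : 0 < η := by positivity
  have hplus := abs_lt.mp (hcont (x := t + η) (by
    rw [Real.dist_eq, add_sub_cancel_left, abs_of_pos hη]; linarith))
  have hminus := abs_lt.mp (hcont (x := t - η) (by
    rw [Real.dist_eq, sub_sub_cancel_left, abs_neg, abs_of_pos hη]; linarith))
  refine ⟨ε / 2 * η ^ 2, by positivity, fun n hn σ hσ hF => ?_⟩
  obtain ⟨hDint, hDle⟩ := integral_diagonalDefect_div_le hp hX hindep hlaw hM hC hn hσ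
  have hN := integrable_eigenvalueFraction (μ := μ) hX n σ t
  have hD : ∫ ω, diagonalDefect p n σ (fun i => X i ω) / n / η ^ 2 ∂μ < ε / 2 := by
    rw [integral_div, div_lt_iff₀ (by positivity)]
    exact hDle.trans_lt hF
  have hDint' := hDint.div_const (η ^ 2)
  obtain ⟨hUint, hU⟩ := integral_card_filter_div hX hlaw hp.measurable (t + η) hn
  obtain ⟨hLint, hL⟩ := integral_card_filter_div hX hlaw hp.measurable (t - η) hn
  have hupper := integral_mono hN (hUint.add hDint')
    fun ω => eigenvalueFraction_le p n σ t (fun i => X i ω) hη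
  have hlower := integral_mono hLint (hN.add hDint')
    fun ω => card_div_le_eigenvalueFraction_add p n σ t (fun i => X i ω) hη
  rw [integral_add' hUint hDint', hU] at hupper
  rw [integral_add' hN hDint', hL] at hlower
  rw [abs_lt]
  constructor <;> linarith [hplus.1, hplus.2, hminus.1, hminus.2]

theorem two_pi_mul_sq_rpow (d : ℕ) {σ : ℝ} (hσ : 0 < σ) :
    (2 * Real.pi * σ ^ 2) ^ ((d : ℝ) / 2) = (2 * Real.pi) ^ ((d : ℝ) / 2) * σ ^ d := by
  rw [Real.mul_rpow (by positivity) (by positivity), ← Real.rpow_natCast σ 2,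
    ← Real.rpow_mul hσ.le, ← Real.rpow_natCast σ d]
  congr 2
  push_cast
  ring

end Comparison

end GraphESD

theorem theorem4 {d : ℕ} (p : EuclideanSpace ℝ (Fin d) → ℝ) (hp : GraphESD.IsDataDensity p)
    {Ω : Type*} [MeasurableSpace Ω] (μ : Measure Ω) [IsProbabilityMeasure μ]
    (X : ℕ → Ω → EuclideanSpace ℝ (Fin d)) (hX : ∀ i, Measurable (X i))
    (hindep : iIndepFun X μ) (hlaw : ∀ i, μ.map (X i) = GraphESD.densityMeasure p)
    (t : ℝ) (ht : GraphESD.densityMeasure p {x | p x = t} = 0) :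
    -- the expectations below are those of integrable random variables
    (∀ (n : ℕ) (σ : ℝ), 0 < σ →
      Integrable (fun ω => GraphESD.eigenvalueFraction n σ (fun i => X i ω) t) μ) ∧
    -- joint limit along every bandwidth sequence with `σ n → 0` and `n (σ n)^d → ∞`
    (∀ σ : ℕ → ℝ, (∀ n, 0 < σ n) → Tendsto σ atTop (𝓝 0) →
      Tendsto (fun n : ℕ => (n : ℝ) * σ n ^ d) atTop atTop →
      Tendsto (fun n : ℕ => ∫ ω, GraphESD.eigenvalueFraction n (σ n) (fun i => X i ω) t ∂μ)
        atTop (𝓝 ((GraphESD.densityMeasure p).real {x | p x ≤ t}))) ∧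
    -- iterated limit: first `n → ∞`, then `σ → 0`
    (∀ ε : ℝ, 0 < ε → ∀ᶠ σ in 𝓝[>] (0 : ℝ), ∀ᶠ n : ℕ in atTop,
      |∫ ω, GraphESD.eigenvalueFraction n σ (fun i => X i ω) t ∂μ -
        (GraphESD.densityMeasure p).real {x | p x ≤ t}| < ε) := by
  obtain ⟨M, hM⟩ := hp.bounded
  obtain ⟨C, hC⟩ := hp.lipschitz
  have hMn : Tendsto (fun n : ℕ => M / (n : ℝ)) atTop (𝓝 0) :=
    tendsto_const_nhds.div_atTop tendsto_natCast_atTop_atTop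
  refine ⟨fun n σ _ => GraphESD.integrable_eigenvalueFraction hX n σ t, ?_, ?_⟩
  · intro σ hσ hσ0 hnσ
    rw [Metric.tendsto_nhds]
    intro ε hε
    obtain ⟨δ, hδ, hclose⟩ := GraphESD.exists_forall_abs_integral_eigenvalueFraction_sub_lt
      hp hX hindep hlaw ht hM hC hε
    have h1 : Tendsto (fun n : ℕ => 5 * M / (2 * Real.pi) ^ ((d : ℝ) / 2) / ((n : ℝ) * σ n ^ d))
        atTop (𝓝 0) := tendsto_const_nhds.div_atTop hnσ
    have h2 := h1.add ((((hσ0.const_mul (C * 2 ^ ((d : ℝ) / 2) : ℝ)).add hMn).pow 2).const_mul 2)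
    simp only [mul_zero, add_zero, ne_eq, OfNat.ofNat_ne_zero, not_false_eq_true,
      zero_pow] at h2
    filter_upwards [h2.eventually (gt_mem_nhds hδ), eventually_gt_atTop 0] with n hn hn0
    refine hclose n hn0 (σ n) (hσ n) (lt_of_eq_of_lt ?_ hn)
    rw [GraphESD.two_pi_mul_sq_rpow d (hσ n)]
    congr 1
    have := hσ n
    field_simp
  · intro ε hε
    obtain ⟨δ, hδ, hclose⟩ := GraphESD.exists_forall_abs_integral_eigenvalueFraction_sub_lt
      hp hX hindep hlaw ht hM hC hε
    have h1 : Tendsto (fun σ : ℝ => 2 * (C * 2 ^ ((d : ℝ) / 2) * σ) ^ 2) (𝓝[>] 0) (𝓝 0) := by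
      have : Continuous fun σ : ℝ => 2 * (C * 2 ^ ((d : ℝ) / 2) * σ) ^ 2 := by fun_prop
      simpa using (this.tendsto 0).mono_left nhdsWithin_le_nhds
    filter_upwards [h1.eventually (gt_mem_nhds hδ), self_mem_nhdsWithin] with σ hσδ hσ
    have h2 : Tendsto (fun n : ℕ =>
        5 * (1 / (2 * Real.pi * σ ^ 2) ^ ((d : ℝ) / 2) * M) / (n : ℝ) +
          2 * (C * 2 ^ ((d : ℝ) / 2) * σ + M / n) ^ 2) atTop
        (𝓝 (0 + 2 * (C * 2 ^ ((d : ℝ) / 2) * σ + 0) ^ 2)) :=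
      (tendsto_const_nhds.div_atTop tendsto_natCast_atTop_atTop).add
        (((tendsto_const_nhds.add hMn).pow 2).const_mul 2)
    rw [zero_add, add_zero] at h2
    filter_upwards [h2.eventually (gt_mem_nhds hσδ), eventually_gt_atTop 0] with n hn hn0
    exact hclose n hn0 σ hσ hn
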